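/- A simple graph on $n$ vertices is called pancyclic if it contains a cycle of length $\ell$ for every integer $\ell$ with $3\le \ell\le n$. Let $m(n)$ be the minimum number of edges of a pancyclic graph on $n$ vertices; a pancyclic graph on $n$ vertices with exactly $m(n)$ edges is called minimal pancyclic. Let $H(n)$ be the smallest non-negative integer $h$ such that $\log_2$ applied $h$ times to $n$ gives a number less than $2$. Proposition. There is an absolute constant $C>0$ such that every minimal pancyclic graph $G$, with $n$ vertices and maximum degree $\Delta>4$, satisfies $$\frac{2^{\Delta}+1}{\Delta^2+3\Delta+4}\;\le\; C\left(\frac{n}{n-1}\right)2^{H(n)}.$$ -/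

import Mathlib

/-- `G` has a cycle of every length `ℓ` with `3 ≤ ℓ ≤ n`, where `n` is its number of vertices. -/
def IsPancyclic {V : Type*} [Fintype V] (G : SimpleGraph V) : Prop :=
  ∀ ℓ : ℕ, 3 ≤ ℓ → ℓ ≤ Fintype.card V → ∃ (v : V) (w : G.Walk v v), w.IsCycle ∧ w.length = ℓ

/-- `m(n)`: the minimum number of edges of a pancyclic graph on `n` vertices
(the set is non-empty, since the complete graph is pancyclic). -/
noncomputable def minPancyclicEdges (n : ℕ) : ℕ :=
  sInf {e : ℕ | ∃ G : SimpleGraph (Fin n), IsPancyclic G ∧ G.edgeSet.ncard = e}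

/-- A pancyclic graph on `n` vertices with exactly `m(n)` edges. -/
def IsMinimalPancyclic {V : Type*} [Fintype V] (G : SimpleGraph V) : Prop :=
  IsPancyclic G ∧ G.edgeSet.ncard = minPancyclicEdges (Fintype.card V)

/-- `H(n)`: the smallest `h` such that `log₂` applied `h` times to `n` gives a number below `2`.
All the iterates before the `h`-th are at least `2`, so only logarithms of numbers `≥ 2` matter. -/
noncomputable def iterLogCount (n : ℕ) : ℕ :=
  sInf {h : ℕ | (Real.logb 2)^[h] (n : ℝ) < 2}

/-- The set in the definition of `iterLogCount` is never empty. -/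
theorem exists_iterate_logb_lt_two (x : ℝ) : ∃ h : ℕ, (Real.logb 2)^[h] x < 2 := by
  have key : ∀ (k : ℕ) (y : ℝ), y < 2 + k → ∃ h : ℕ, (Real.logb 2)^[h] y < 2 := by
    intro k
    induction k with
    | zero => intro y hy; exact ⟨0, by simpa using hy⟩
    | succ k ih =>
      intro y hy
      by_cases h2 : y < 2
      · exact ⟨0, by simpa using h2⟩
      · have h2' : 2 ≤ y := not_lt.mp h2
        have hb : 1 + (y - 1) * 1 ≤ (1 + 1 : ℝ) ^ (y - 1) := by
          exact one_add_mul_self_le_rpow_one_add (by norm_num) (by linarith)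
        have hl : Real.logb 2 y ≤ y - 1 := by
          rw [Real.logb_le_iff_le_rpow (by norm_num) (by linarith)]
          norm_num at hb ⊢
          exact hb
        push_cast at hy
        obtain ⟨h, hh⟩ := ih (Real.logb 2 y) (by linarith)
        exact ⟨h + 1, by simpa [Function.iterate_succ_apply] using hh⟩
  obtain ⟨k, hk⟩ := exists_nat_gt x
  exact key k x (by linarith)

/-! The number of edges `m(n)` is bounded from both sides. In a pancyclic graph fix a Hamiltonian
cycle and a vertex `v` of degree `Δ`. A cycle is determined by its edges at `v` (none or two) and
its edges among the `f` chords missing `v`: two cycles with the same data differ by an even edge set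
inside a path, which is empty. So `n - 2 ≤ 2 ^ f * (1 + Δ.choose 2)`, where `f ≤ m(n) - n - Δ + 2`
(`IsPancyclic.card_le`). Conversely, an `n`-cycle with about `log₂ n` shortcuts and `H(n) + 1`
chords at `0` is pancyclic (`minPancyclicEdges_le`). Substituting this bound on `m(n)` into the
first gives the claim. -/

/-! ### Cycles as even edge sets -/

namespace SimpleGraph.Walk

variable {V : Type*} {G : SimpleGraph V}

/-- A set of edges of a path meeting every vertex other than the end of the path an even number
of times is empty. -/
theorem IsPath.eq_empty_of_even_card_filter [DecidableEq V] {u v : V} {p : G.Walk u v}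
    (hp : p.IsPath) {D : Finset (Sym2 V)} (hD : ∀ e ∈ D, e ∈ p.edges)
    (heven : ∀ x, Even (D.filter (x ∈ ·)).card) : D = ∅ := by
  induction p with
  | nil => exact Finset.eq_empty_of_forall_notMem fun e he => by simpa using hD e he
  | @cons u x v h p ih =>
    rw [cons_isPath_iff] at hp
    -- Only the first edge of a path meets its start, so having that edge in `D` would give `u` the
    -- odd count 1.
    have hu : ∀ e ∈ D, u ∈ e → e = s(u, x) := by
      intro e he hue
      rcases List.mem_cons.1 (hD e he) with h1 | h1
      · exact h1
      · exact absurd (p.mem_support_of_mem_edges h1 hue) hp.2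
    have hnot : s(u, x) ∉ D := by
      intro hmem
      have : D.filter (u ∈ ·) = {s(u, x)} := by
        ext e
        simp only [Finset.mem_filter, Finset.mem_singleton]
        constructor
        · rintro ⟨h1, h2⟩
          exact hu e h1 h2
        · rintro rfl
          exact ⟨hmem, by simp⟩
      have h2 := heven u
      rw [this] at h2
      simp at h2
    refine ih hp.1 fun e he => ?_
    rcases List.mem_cons.1 (hD e he) with h1 | h1
    · have h2 : e = s(u, x) := h1
      exact absurd (h2 ▸ he) hnot
    · exact h1

theorem IsTrail.even_card_filter_edges [DecidableEq V] {u : V} {p : G.Walk u u}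
    (hp : p.IsTrail) (x : V) : Even (p.edges.toFinset.filter (x ∈ ·)).card := by
  have h := (hp.even_countP_edges_iff x).2 (fun h => absurd rfl h)
  have hfilter : p.edges.toFinset.filter (x ∈ ·) =
      (p.edges.filter fun e => decide (x ∈ e)).toFinset := by
    ext e
    simp
  rwa [hfilter, List.toFinset_card_of_nodup (hp.edges_nodup.filter _),
    ← List.countP_eq_length_filter]

theorem IsCycle.card_filter_edges_le_two [DecidableEq V] {u : V} {p : G.Walk u u}
    (hp : p.IsCycle) (x : V) : (p.edges.toFinset.filter (x ∈ ·)).card ≤ 2 := by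
  by_cases hx : x ∈ p.support
  · have h2 := hp.ncard_neighborSet_toSubgraph_eq_two hx
    rw [← Set.ncard_coe_finset, ← h2]
    refine le_trans (Set.ncard_le_ncard ?_ ((p.finite_neighborSet_toSubgraph).image _))
      (Set.ncard_image_le (f := fun y => s(x, y)) p.finite_neighborSet_toSubgraph)
    intro e he
    simp only [Finset.coe_filter, List.mem_toFinset, Set.mem_ofPred_eq] at he
    obtain ⟨y, rfl⟩ := he.2
    refine ⟨y, ?_, rfl⟩
    exact (p.mem_edges_toSubgraph).2 he.1
  · rw [Finset.filter_eq_empty_iff.2]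
    · simp
    · intro e he hxe
      exact hx (p.mem_support_of_mem_edges (List.mem_toFinset.1 he) hxe)

/-- The end points of a path of length at least two are not joined by an edge of the path. -/
theorem IsPath.endpoints_notMem_edges {u v : V} {p : G.Walk u v} (hp : p.IsPath)
    (hl : 2 ≤ p.length) : s(v, u) ∉ p.edges := by
  cases p with
  | nil => simp
  | @cons _ x _ h p =>
    rw [cons_isPath_iff] at hp
    intro hmem
    rcases List.mem_cons.1 hmem with h1 | h1
    · have hvx : v = x := by
        rw [Sym2.eq_swap] at h1
        exact Sym2.congr_right.1 h1
      subst hvx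
      have := length_eq_zero_iff.2 (isPath_iff_nil.1 hp.1)
      rw [length_cons] at hl
      omega
    · exact hp.2 (p.snd_mem_support_of_mem_edges h1)

end SimpleGraph.Walk

open Finset in
theorem Finset.even_card_symmDiff {α : Type*} [DecidableEq α] {s t : Finset α}
    (hs : Even s.card) (ht : Even t.card) : Even (symmDiff s t).card := by
  have h1 : (symmDiff s t).card = (s \ t).card + (t \ s).card := by
    rw [symmDiff_def, sup_eq_union, card_union_of_disjoint disjoint_sdiff_sdiff]
  have h2 := card_sdiff_add_card_inter s t
  have h3 := card_sdiff_add_card_inter t s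
  rw [inter_comm] at h3
  rw [Nat.even_iff] at *
  omega

/-- Two families of edges which meet every vertex evenly, and which agree off a cycle
and at a vertex `v` of that cycle, are equal. -/
theorem SimpleGraph.Walk.IsCycle.eq_of_even_of_agree {V : Type*} [DecidableEq V]
    {G : SimpleGraph V} {v : V} {w : G.Walk v v} (hw : w.IsCycle) {X Y : Finset (Sym2 V)}
    (hX : ∀ x, Even (X.filter (x ∈ ·)).card) (hY : ∀ x, Even (Y.filter (x ∈ ·)).card)
    (hoff : ∀ e, e ∉ w.edges → (e ∈ X ↔ e ∈ Y)) (hv : ∀ e, v ∈ e → (e ∈ X ↔ e ∈ Y)) :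
    X = Y := by
  rw [← symmDiff_eq_bot, Finset.bot_eq_empty]
  cases w with
  | nil => simp at hw
  | @cons _ x _ h p =>
    rw [cons_isCycle_iff] at hw
    -- Dropping the first edge of the cycle, which meets `v`, leaves a path that still contains the
    -- difference of `X` and `Y`.
    refine hw.1.eq_empty_of_even_card_filter ?_ ?_
    · intro e he
      rw [Finset.mem_symmDiff] at he
      by_contra hp
      by_cases hve : v ∈ e
      · have := hv e hve
        tauto
      · have := hoff e (by
          rw [edges_cons, List.mem_cons, not_or]
          refine ⟨?_, hp⟩
          rintro rfl
          simp at hve)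
        tauto
    · intro y
      have : (symmDiff X Y).filter (y ∈ ·) = symmDiff (X.filter (y ∈ ·)) (Y.filter (y ∈ ·)) := by
        ext e
        simp only [Finset.mem_filter, Finset.mem_symmDiff]
        tauto
      rw [this]
      exact Finset.even_card_symmDiff (hX y) (hY y)

/-! ### Lower bound on the number of edges -/

/-- A pancyclic graph with a vertex of degree `d` has many edges, as a cycle is determined by its
edges at that vertex and its chords of a fixed Hamiltonian cycle. -/
theorem IsPancyclic.card_le {V : Type*} [Fintype V] {G : SimpleGraph V} [DecidableRel G.Adj]
    (hG : IsPancyclic G) (hn : 3 ≤ Fintype.card V) (v : V) :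
    ∃ f : ℕ, f + Fintype.card V + G.degree v ≤ G.edgeSet.ncard + 2 ∧
      Fintype.card V ≤ 2 ^ f * (1 + (G.degree v).choose 2) + 2 := by
  classical
  obtain ⟨u, c, hc, hcl⟩ := hG _ hn le_rfl
  have hham : c.IsHamiltonianCycle :=
    SimpleGraph.Walk.isHamiltonianCycle_iff_isCycle_and_length_eq.2 ⟨hc, hcl⟩
  have hvc := hham.mem_support v
  set w := c.rotate v hvc
  have hw : w.IsCycle := hc.rotate hvc
  have hwl : w.edges.toFinset.card = Fintype.card V := by
    rw [List.toFinset_card_of_nodup hw.edges_nodup, ← hcl, ← SimpleGraph.Walk.length_edges c]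
    exact (c.rotate_edges v hvc).perm.length_eq
  have hsub : ∀ {x : V} (p : G.Walk x x), p.edges.toFinset ⊆ G.edgeFinset := by
    intro x p e he
    rw [SimpleGraph.mem_edgeFinset]
    exact p.edges_subset_edgeSet (List.mem_toFinset.1 he)
  set C := w.edges.toFinset
  set I := G.incidenceFinset v with hI
  set F := G.edgeFinset \ (C ∪ I)
  have hmI : ∀ e, e ∈ I ↔ e ∈ G.edgeFinset ∧ v ∈ e := by
    intro e
    simp [hI, SimpleGraph.incidenceSet]
  refine ⟨F.card, ?_, ?_⟩
  · have h1 : F.card + (C ∪ I).card = G.edgeFinset.card :=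
      Finset.card_sdiff_add_card_eq_card
        (Finset.union_subset (hsub w) (G.incidenceFinset_subset v))
    have h2 := Finset.card_union_add_card_inter C I
    -- This overlap is the `+ 2` in the edge count.
    have h3 : (C ∩ I).card ≤ 2 := by
      refine le_trans (Finset.card_le_card ?_) (hw.card_filter_edges_le_two v)
      intro e he
      rw [Finset.mem_inter, hmI] at he
      exact Finset.mem_filter.2 ⟨he.1, he.2.2⟩
    have h4 : I.card = G.degree v := G.card_incidenceFinset_eq_degree v
    have h5 : G.edgeSet.ncard = G.edgeFinset.card := by
      rw [← SimpleGraph.coe_edgeFinset, Set.ncard_coe_finset]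
    omega
  · choose s p hp hpl using hG
    let X : ℕ → Finset (Sym2 V) := fun l =>
      if h : 3 ≤ l ∧ l ≤ Fintype.card V then (p l h.1 h.2).edges.toFinset else ∅
    have hX : ∀ l (h : 3 ≤ l ∧ l ≤ Fintype.card V), X l = (p l h.1 h.2).edges.toFinset :=
      fun l h => dif_pos h
    have hXcard : ∀ l, 3 ≤ l ∧ l ≤ Fintype.card V → (X l).card = l := by
      intro l h
      rw [hX l h, List.toFinset_card_of_nodup (hp l h.1 h.2).edges_nodup,
        SimpleGraph.Walk.length_edges, hpl]
    have hXsub : ∀ l, 3 ≤ l ∧ l ≤ Fintype.card V → X l ⊆ G.edgeFinset := by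
      intro l h
      rw [hX l h]
      exact hsub _
    have hXeven : ∀ l, 3 ≤ l ∧ l ≤ Fintype.card V → ∀ x, Even ((X l).filter (x ∈ ·)).card := by
      intro l h x
      rw [hX l h]
      exact (hp l h.1 h.2).isTrail.even_card_filter_edges x
    have hXI : ∀ l, 3 ≤ l ∧ l ≤ Fintype.card V → X l ∩ I = (X l).filter (v ∈ ·) := by
      intro l h
      ext e
      rw [Finset.mem_inter, hmI, Finset.mem_filter]
      have := @hXsub l h e
      tauto
    -- Each of the `n - 2` lengths is encoded by the traces of one cycle of that length; the trace
    -- at `v` is even and at most 2.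
    have hcount := Finset.card_le_card_of_injOn (s := Finset.Icc 3 (Fintype.card V))
      (t := F.powerset ×ˢ (I.powersetCard 0 ∪ I.powersetCard 2))
      (fun l => (X l ∩ F, X l ∩ I)) ?_ ?_
    · rw [Nat.card_Icc, Finset.card_product, Finset.card_powerset] at hcount
      have h6 : (I.powersetCard 0 ∪ I.powersetCard 2).card ≤ 1 + (G.degree v).choose 2 := by
        refine (Finset.card_union_le _ _).trans ?_
        rw [Finset.card_powersetCard, Finset.card_powersetCard,
          G.card_incidenceFinset_eq_degree v, Nat.choose_zero_right]
      have := Nat.mul_le_mul_left (2 ^ F.card) h6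
      omega
    · intro l hl
      have hl' := Finset.mem_Icc.1 hl
      refine Finset.mem_coe.2 (Finset.mem_product.2 ⟨?_, ?_⟩)
      · exact Finset.mem_powerset.2 Finset.inter_subset_right
      · rw [Finset.mem_union, Finset.mem_powersetCard, Finset.mem_powersetCard]
        have h1 : (X l ∩ I).card ≤ 2 := by
          rw [hXI l hl', hX l hl']
          exact (hp l hl'.1 hl'.2).card_filter_edges_le_two v
        have h2 : Even (X l ∩ I).card := by
          rw [hXI l hl']
          exact hXeven l hl' v
        have h3 : X l ∩ I ⊆ I := Finset.inter_subset_right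
        rw [Nat.even_iff] at h2
        have : (X l ∩ I).card = 0 ∨ (X l ∩ I).card = 2 := by omega
        exact this.imp (fun h => ⟨h3, h⟩) (fun h => ⟨h3, h⟩)
    · intro l hl l' hl' heq
      have hl := Finset.mem_Icc.1 hl
      have hl' := Finset.mem_Icc.1 hl'
      obtain ⟨h1, h2⟩ := Prod.mk.inj heq
      have hI' : ∀ e, e ∈ I → (e ∈ X l ↔ e ∈ X l') := by
        intro e he
        have := Finset.ext_iff.1 h2 e
        simpa [he] using this
      have hF' : ∀ e, e ∈ F → (e ∈ X l ↔ e ∈ X l') := by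
        intro e he
        have := Finset.ext_iff.1 h1 e
        simpa [he] using this
      have hE' : ∀ e, e ∉ G.edgeFinset → (e ∈ X l ↔ e ∈ X l') := fun e he =>
        ⟨fun h => absurd (hXsub l hl h) he, fun h => absurd (hXsub l' hl' h) he⟩
      have key : X l = X l' := by
        refine hw.eq_of_even_of_agree (hXeven l hl) (hXeven l' hl') ?_ ?_
        · intro e he
          by_cases h3 : e ∈ G.edgeFinset
          · by_cases h4 : e ∈ I
            · exact hI' e h4
            · refine hF' e (Finset.mem_sdiff.2 ⟨h3, ?_⟩)
              rw [Finset.mem_union, not_or]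
              exact ⟨fun h => he (List.mem_toFinset.1 h), h4⟩
          · exact hE' e h3
        · intro e he
          by_cases h3 : e ∈ G.edgeFinset
          · exact hI' e ((hmI e).2 ⟨h3, he⟩)
          · exact hE' e h3
      rw [← hXcard l hl, ← hXcard l' hl', key]

/-! ### Paths through shortcuts -/

/-- `0` is joined to `x` by a path of length `l` all of whose vertices are at most `x`. -/
def HasInitialPath {n : ℕ} [NeZero n] (G : SimpleGraph (Fin n)) (l x : ℕ) : Prop :=
  ∃ p : G.Walk 0 (Fin.ofNat n x), p.IsPath ∧ p.length = l ∧ ∀ y ∈ p.support, y.val ≤ x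

section InitialPath

variable {n : ℕ} [NeZero n] {G : SimpleGraph (Fin n)}

theorem hasInitialPath_zero : HasInitialPath G 0 0 :=
  ⟨.nil, by simp, rfl, by simp⟩

theorem HasInitialPath.step {l x y : ℕ} (h : HasInitialPath G l x) (hxy : x < y) (hy : y < n)
    (hadj : G.Adj (Fin.ofNat n x) (Fin.ofNat n y)) : HasInitialPath G (l + 1) y := by
  obtain ⟨p, hp, hl, hs⟩ := h
  have hval : (Fin.ofNat n y).val = y := Nat.mod_eq_of_lt hy
  refine ⟨p.concat hadj, hp.concat (fun hmem => ?_) hadj, by simp [hl], fun z hz => ?_⟩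
  · have := hs _ hmem
    omega
  · rw [SimpleGraph.Walk.support_concat, List.mem_append,
      List.mem_singleton] at hz
    rcases hz with hz | rfl
    · exact (hs z hz).trans hxy.le
    · exact hval.le

theorem HasInitialPath.advance
    (hpath : ∀ i, i + 1 < n → G.Adj (Fin.ofNat n i) (Fin.ofNat n (i + 1))) {l x : ℕ}
    (h : HasInitialPath G l x) (d : ℕ) (hd : x + d < n) : HasInitialPath G (l + d) (x + d) := by
  induction d with
  | zero => exact h
  | succ d ih => exact (ih (by omega)).step (by omega) hd (hpath _ hd)

theorem HasInitialPath.exists_isCycle {l x : ℕ} (h : HasInitialPath G l x) (hl : 2 ≤ l)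
    (hadj : G.Adj (Fin.ofNat n x) 0) :
    ∃ (v : Fin n) (w : G.Walk v v), w.IsCycle ∧ w.length = l + 1 := by
  obtain ⟨p, hp, rfl, -⟩ := h
  exact ⟨_, .cons hadj p, (SimpleGraph.Walk.cons_isCycle_iff p hadj).2
    ⟨hp, hp.endpoints_notMem_edges hl⟩, rfl⟩

/-- With shortcuts between the vertices `2 ^ i + i - 1`, there are initial paths of all
conceivable lengths ending there. -/
theorem hasInitialPath_shortcut {k : ℕ} (hk : 2 ^ k + k ≤ n)
    (hpath : ∀ i, i + 1 < n → G.Adj (Fin.ofNat n i) (Fin.ofNat n (i + 1)))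
    (hshort : ∀ i < k, G.Adj (Fin.ofNat n (2 ^ i + i - 1)) (Fin.ofNat n (2 ^ (i + 1) + i)))
    (j : ℕ) (hj : j ≤ k) (l : ℕ) (hl : j ≤ l) (hl' : l < 2 ^ j + j) :
    HasInitialPath G l (2 ^ j + j - 1) := by
  induction j generalizing l with
  | zero =>
    obtain rfl : l = 0 := by simpa using hl'
    exact hasInitialPath_zero
  | succ j ih =>
    have hpow : 2 ^ (j + 1) = 2 * 2 ^ j := by ring
    have hpos : 0 < 2 ^ j := by positivity
    have hjk : 2 ^ (j + 1) ≤ 2 ^ k := Nat.pow_le_pow_right (by norm_num) hj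
    -- The shortcut adds one edge and its bypass `2 ^ j + 1`, so the two ranges of lengths are
    -- adjacent.
    by_cases h : l ≤ 2 ^ j + j
    · have := (ih (by omega) (l - 1) (by omega) (by omega)).step
        (y := 2 ^ (j + 1) + j) (by omega) (by omega) (hshort j (by omega))
      rwa [show l - 1 + 1 = l by omega] at this
    · have := (ih (by omega) (l - (2 ^ j + 1)) (by omega) (by omega)).advance hpath (2 ^ j + 1)
        (by omega)
      convert this using 1 <;> omega

end InitialPath

/-! ### A sparse pancyclic graph -/

/-- The lengths of the initial segments closed up by chords: each is one less than the least cycle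
length that the preceding ones do not provide. -/
def segmentLength : ℕ → ℕ
  | 0 => 2
  | t + 1 => 2 ^ segmentLength t + segmentLength t

theorem lt_segmentLength_of_iterate_logb {h : ℕ} {x : ℝ} (hx : (Real.logb 2)^[h] x < 2) :
    x < segmentLength h := by
  induction h generalizing x with
  | zero => simpa [segmentLength] using hx
  | succ h ih =>
    have h1 := ih (x := Real.logb 2 x) (by simpa using hx)
    -- For `x ≤ 0` the value of `logb` says nothing about the size of `x`, but the bound is trivial.
    rcases le_or_gt x 0 with h0 | h0
    · exact h0.trans_lt (by simp only [segmentLength]; positivity)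
    · rw [Real.logb_lt_iff_lt_rpow (by norm_num) h0, Real.rpow_natCast] at h1
      refine h1.trans_le ?_
      simp [segmentLength]

theorem lt_segmentLength_iterLogCount (n : ℕ) : n < segmentLength (iterLogCount n) := by
  have h : (Real.logb 2)^[iterLogCount n] (n : ℝ) < 2 :=
    Nat.sInf_mem (s := {h : ℕ | (Real.logb 2)^[h] (n : ℝ) < 2}) (exists_iterate_logb_lt_two n)
  exact_mod_cast lt_segmentLength_of_iterate_logb h

/-- The upper bound leaves at most `2 ^ k` edges between the last shortcut and `n - 1`, so that
cycles through this stretch leave no gap in the lengths. -/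
theorem exists_two_pow_add_le (n : ℕ) (hn : 6 ≤ n) :
    ∃ k, 2 ≤ k ∧ 2 ^ k + k ≤ n ∧ n ≤ 2 ^ (k + 1) + k := by
  induction n, hn using Nat.le_induction with
  | base => exact ⟨2, by norm_num⟩
  | succ n _ ih =>
    obtain ⟨k, h1, h2, h3⟩ := ih
    by_cases h : n + 1 ≤ 2 ^ (k + 1) + k
    · exact ⟨k, h1, by omega, h⟩
    · refine ⟨k + 1, by omega, by omega, ?_⟩
      have : 2 ^ (k + 1 + 1) = 2 * 2 ^ (k + 1) := by ring
      have : 0 < 2 ^ (k + 1) := by positivity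
      omega

/-- An `n`-cycle with shortcuts and with chords at `0` closing up initial segments is pancyclic. -/
theorem isPancyclic_of_shortcuts {n k h : ℕ} [NeZero n] {G : SimpleGraph (Fin n)} (hk : 2 ≤ k)
    (hkn : 2 ^ k + k ≤ n) (hnk : n ≤ 2 ^ (k + 1) + k) (hh : k ≤ segmentLength h)
    (hpath : ∀ i, i + 1 < n → G.Adj (Fin.ofNat n i) (Fin.ofNat n (i + 1)))
    (hclose : G.Adj (Fin.ofNat n (n - 1)) 0)
    (hshort : ∀ i < k, G.Adj (Fin.ofNat n (2 ^ i + i - 1)) (Fin.ofNat n (2 ^ (i + 1) + i)))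
    (hchord : ∀ t ≤ h, G.Adj (Fin.ofNat n
      (2 ^ min (segmentLength t) k + min (segmentLength t) k - 1)) 0) :
    IsPancyclic G := by
  have hinit := hasInitialPath_shortcut hkn hpath hshort
  -- With `q = min (segmentLength t) k`, the initial paths have lengths `q` to `2 ^ q + q - 1`, and
  -- the chord adds one.
  have hcyc : ∀ t ≤ h, ∀ l, min (segmentLength t) k < l → 3 ≤ l →
      l ≤ 2 ^ min (segmentLength t) k + min (segmentLength t) k →
      ∃ (v : Fin n) (w : G.Walk v v), w.IsCycle ∧ w.length = l := by
    intro t ht l h1 h2 h3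
    have := (hinit _ (min_le_right (segmentLength t) k) (l - 1) (by omega)
      (by omega)).exists_isCycle (by omega) (hchord t ht)
    rwa [show l - 1 + 1 = l by omega] at this
  have hsmall : ∀ t ≤ h, ∀ l, 3 ≤ l →
      l ≤ 2 ^ min (segmentLength t) k + min (segmentLength t) k →
      ∃ (v : Fin n) (w : G.Walk v v), w.IsCycle ∧ w.length = l := by
    intro t
    induction t with
    | zero =>
      intro ht l h1 h2
      refine hcyc 0 ht l ?_ h1 h2
      simp only [segmentLength]
      omega
    | succ t ih =>
      intro ht l h1 h2
      by_cases h3 : l ≤ 2 ^ min (segmentLength t) k + min (segmentLength t) k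
      · exact ih (by omega) l h1 h3
      · refine hcyc (t + 1) ht l ?_ h1 h2
        -- Once the minimum is `k`, later chords coincide and no new length is left to treat.
        rcases le_total k (segmentLength t) with h4 | h4
        · have h5 : k ≤ segmentLength (t + 1) := h4.trans (Nat.le_add_left _ _)
          rw [min_eq_right h4] at h3
          rw [min_eq_right h5] at h2
          exact absurd h2 h3
        · rw [min_eq_left h4] at h3
          exact (min_le_left _ _).trans_lt (not_le.1 h3)
  intro l h3 hl
  rw [Fintype.card_fin] at hl
  have hpow : 2 ^ (k + 1) = 2 * 2 ^ k := by ring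
  by_cases h4 : l ≤ 2 ^ k + k
  · exact hsmall h le_rfl l h3 (by rwa [min_eq_right hh])
  · have := ((hinit k le_rfl (l - 1 - (n - (2 ^ k + k))) (by omega) (by omega)).advance hpath
      (n - (2 ^ k + k)) (by omega))
    rw [show 2 ^ k + k - 1 + (n - (2 ^ k + k)) = n - 1 by omega,
      show l - 1 - (n - (2 ^ k + k)) + (n - (2 ^ k + k)) = l - 1 by omega] at this
    have := this.exists_isCycle (by omega) hclose
    rwa [show l - 1 + 1 = l by omega] at this

theorem Set.ncard_range_le_card {ι α : Type*} [Fintype ι] (f : ι → α) :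
    (Set.range f).ncard ≤ Fintype.card ι := by
  rw [← Set.image_univ, ← Nat.card_eq_fintype_card, ← Set.ncard_univ]
  exact Set.ncard_image_le Set.finite_univ

/-- The minimum number of edges of a pancyclic graph is at most `n + log₂ n + H(n) + 1`. -/
theorem minPancyclicEdges_le (n : ℕ) (hn : 6 ≤ n) :
    ∃ k, 2 ^ k ≤ n ∧ minPancyclicEdges n ≤ n + k + iterLogCount n + 1 := by
  obtain ⟨k, hk, hkn, hnk⟩ := exists_two_pow_add_le n hn
  have : NeZero n := ⟨by omega⟩
  refine ⟨k, by omega, ?_⟩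
  set H := iterLogCount n
  -- `Fin.ofNat` reduces modulo `n`, so the closing edge is included.
  let c : Fin n → Sym2 (Fin n) := fun i => s(i, Fin.ofNat n (i + 1))
  let s : Fin k → Sym2 (Fin n) := fun i =>
    s(Fin.ofNat n (2 ^ (i : ℕ) + i - 1), Fin.ofNat n (2 ^ ((i : ℕ) + 1) + i))
  let d : Fin (H + 1) → Sym2 (Fin n) := fun t =>
    s(Fin.ofNat n (2 ^ min (segmentLength t) k + min (segmentLength t) k - 1), 0)
  let S : Set (Sym2 (Fin n)) := Set.range c ∪ Set.range s ∪ Set.range d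
  let G := SimpleGraph.fromEdgeSet S
  have hval : ∀ x, x < n → (Fin.ofNat n x).val = x := fun x hx => Nat.mod_eq_of_lt hx
  have hadj : ∀ x y, x < n → y < n → x ≠ y → s(Fin.ofNat n x, Fin.ofNat n y) ∈ S →
      G.Adj (Fin.ofNat n x) (Fin.ofNat n y) := by
    intro x y hx hy hxy hS
    refine (SimpleGraph.fromEdgeSet_adj _).2 ⟨hS, fun h => hxy ?_⟩
    rw [← hval x hx, ← hval y hy, h]
  have hzero : (0 : Fin n) = Fin.ofNat n 0 := rfl
  have hG : IsPancyclic G := by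
    refine isPancyclic_of_shortcuts (h := H) hk hkn hnk ?_ ?_ ?_ ?_ ?_
    · have h1 : n < segmentLength H := lt_segmentLength_iterLogCount n
      have h2 : 0 < 2 ^ k := by positivity
      omega
    · intro i hi
      refine hadj i (i + 1) (by omega) hi (by omega) (Or.inl (Or.inl ⟨Fin.ofNat n i, ?_⟩))
      simp only [c]
      rw [hval i (by omega)]
    · rw [hzero]
      refine hadj (n - 1) 0 (by omega) (by omega) (by omega)
        (Or.inl (Or.inl ⟨Fin.ofNat n (n - 1), ?_⟩))
      simp only [c]
      rw [hval _ (by omega), show n - 1 + 1 = n by omega]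
      rw [show Fin.ofNat n n = Fin.ofNat n 0 from Fin.ext (by simp)]
    · intro i hi
      have h1 : 2 ^ (i + 1) ≤ 2 ^ k := Nat.pow_le_pow_right (by norm_num) hi
      have h2 : 2 ^ (i + 1) = 2 * 2 ^ i := by ring
      have h3 : 0 < 2 ^ i := by positivity
      exact hadj _ _ (by omega) (by omega) (by omega) (Or.inl (Or.inr ⟨⟨i, hi⟩, rfl⟩))
    · intro t ht
      have h1 : 2 ^ min (segmentLength t) k ≤ 2 ^ k :=
        Nat.pow_le_pow_right (by norm_num) (min_le_right _ _)
      have h2 : min (segmentLength t) k ≤ k := min_le_right _ _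
      have h3 : 2 ≤ segmentLength t := by
        cases t with
        | zero => exact le_rfl
        | succ t =>
          have := Nat.lt_two_pow_self (n := segmentLength t)
          have : 0 < segmentLength t := by cases t <;> simp [segmentLength]
          simp only [segmentLength]
          omega
      have h4 : 2 ≤ min (segmentLength t) k := le_min h3 hk
      have hd : s(Fin.ofNat n (2 ^ min (segmentLength t) k + min (segmentLength t) k - 1),
          Fin.ofNat n 0) ∈ S := Or.inr ⟨⟨t, by omega⟩, rfl⟩
      rw [hzero]
      generalize min (segmentLength t) k = q at *
      have h5 : 0 < 2 ^ q := by positivity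
      exact hadj (2 ^ q + q - 1) 0 (by omega) (by omega) (by omega) hd
  calc minPancyclicEdges n ≤ G.edgeSet.ncard := Nat.sInf_le ⟨G, hG, rfl⟩
    _ ≤ S.ncard := Set.ncard_le_ncard
        (by rw [SimpleGraph.edgeSet_fromEdgeSet]; exact Set.sdiff_subset) (Set.toFinite S)
    _ ≤ n + k + (H + 1) := by
        refine (Set.ncard_union_le _ _).trans (add_le_add
          ((Set.ncard_union_le _ _).trans (add_le_add ?_ ?_)) ?_)
        · exact (Set.ncard_range_le_card c).trans_eq (Fintype.card_fin n)
        · exact (Set.ncard_range_le_card s).trans_eq (Fintype.card_fin k)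
        · exact (Set.ncard_range_le_card d).trans_eq (Fintype.card_fin _)
    _ = n + k + H + 1 := by ring

/-! ### Comparison of the two bounds -/

theorem mainTheorem9 :
    ∃ C : ℝ, 0 < C ∧
      ∀ (V : Type*) [Fintype V] (G : SimpleGraph V) [DecidableRel G.Adj],
        IsMinimalPancyclic G → 4 < G.maxDegree →
          ((2 : ℝ) ^ G.maxDegree + 1) /
              ((G.maxDegree : ℝ) ^ 2 + 3 * (G.maxDegree : ℝ) + 4) ≤
            C * ((Fintype.card V : ℝ) / ((Fintype.card V : ℝ) - 1)) *
              (2 : ℝ) ^ iterLogCount (Fintype.card V) := by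
  -- `16 = 8 * 4 / 2`: `8` from `f + D ≤ k + H + 3`, `4` from `h1`, and the `2` is the denominator
  -- of the binomial coefficient.
  refine ⟨16, by norm_num, ?_⟩
  intro V _ G _ hG hdeg
  have hV : Nonempty V := by
    by_contra h
    rw [not_nonempty_iff] at h
    simp at hdeg
  obtain ⟨v, hv⟩ := G.exists_maximal_degree_vertex
  have hn : 6 ≤ Fintype.card V := by
    have := G.degree_lt_card_verts v
    omega
  obtain ⟨f, hf, hcard⟩ := hG.1.card_le (by omega) v
  obtain ⟨k, hk, hm⟩ := minPancyclicEdges_le _ hn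
  rw [hG.2, ← hv] at hf
  rw [← hv] at hcard
  generalize G.maxDegree = D at *
  generalize Fintype.card V = n at *
  generalize iterLogCount n = H at *
  have hmain : (n - 2) * 2 ^ D ≤ n * 2 ^ H * (8 * (1 + D.choose 2)) := by
    calc (n - 2) * 2 ^ D ≤ 2 ^ f * (1 + D.choose 2) * 2 ^ D :=
          Nat.mul_le_mul_right _ (by omega)
      _ = 2 ^ (f + D) * (1 + D.choose 2) := by ring
      _ ≤ 2 ^ (k + H + 3) * (1 + D.choose 2) :=
          Nat.mul_le_mul_right _ (Nat.pow_le_pow_right (by norm_num) (by omega))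
      _ = 2 ^ k * (2 ^ H * (8 * (1 + D.choose 2))) := by ring
      _ ≤ n * (2 ^ H * (8 * (1 + D.choose 2))) := Nat.mul_le_mul_right _ hk
      _ = _ := by ring
  have hmainR : ((n : ℝ) - 2) * 2 ^ D ≤ n * 2 ^ H * (8 * (1 + D * (D - 1) / 2)) := by
    have h := (Nat.cast_le (α := ℝ)).2 hmain
    push_cast [Nat.cast_choose_two, Nat.cast_sub (show 2 ≤ n by omega)] at h
    exact h
  have hn' : (6 : ℝ) ≤ n := by exact_mod_cast hn
  have hD : (0 : ℝ) ≤ D := by positivity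
  have h2D : (1 : ℝ) ≤ 2 ^ D := one_le_pow₀ (by norm_num)
  have h2H : (0 : ℝ) < 2 ^ H := by positivity
  have hP : (0 : ℝ) ≤ n * 2 ^ H := by positivity
  rw [mul_div_assoc', div_mul_eq_mul_div, div_le_div_iff₀ (by positivity) (by linarith)]
  -- One factor 2 each for `2 ^ D + 1 ≤ 2 * 2 ^ D` and `n - 1 ≤ 2 * (n - 2)`.
  have h1 : ((2 : ℝ) ^ D + 1) * (n - 1) ≤ 4 * (((n : ℝ) - 2) * 2 ^ D) := by nlinarith
  have h2 : (n : ℝ) * 2 ^ H * (D ^ 2 - D + 2) ≤ n * 2 ^ H * (D ^ 2 + 3 * D + 4) :=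
    mul_le_mul_of_nonneg_left (by linarith) hP
  linarith
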